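/- Let $k$ be a field and let $\mathcal{E}$ be a finite EI category, that is, a category with finitely many objects and morphisms in which every endomorphism is an isomorphism; assume that $\mathcal{E}$ is skeletal. A morphism is called unfactorizable if it is not an isomorphism and, whenever it is written as a composite of two morphisms, one of the two is an isomorphism. Assume that $\mathcal{E}$ is free: whenever a non-isomorphism has two decompositions $\alpha_m\cdots\alpha_1=\beta_n\cdots\beta_1$ into unfactorizable morphisms, passing through objects $x_0,\dots,x_m$ and $y_0,\dots,y_n$ respectively, then $m=n$, $x_i=y_i$ for all $i$, and there are $h_i\in\operatorname{Aut}_{\mathcal{E}}(x_i)$ for $0\le i\le n$ with $h_0=1$, $h_n=1$ and $h_i\alpha_i=\beta_i h_{i-1}$ for $1\le i\le n$. Call an object $x$ left regular if for every morphism $\alpha$ with target $x$ the order of the stabilizer $\{g\in\operatorname{Aut}_{\mathcal{E}}(x) : g\alpha=\alpha\}$ is invertible in $k$, and right regular if for every morphism $\beta$ with source $x$ the order of the stabilizer $\{g\in\operatorname{Aut}_{\mathcal{E}}(x) : \beta g=\beta\}$ is invertible in $k$. Suppose that every object of $\mathcal{E}$ is left regular or right regular. Let $A=k\mathcal{E}$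 be the category algebra: its basis is the set of morphisms, and $\beta\cdot\alpha=\beta\circ\alpha$ if this composite exists, $\beta\cdot\alpha=0$ otherwise. For $n\ge 0$ let $A_n$ be the span of the morphisms of length $n$, where isomorphisms have length $0$ and a composite of $n\ge1$ unfactorizable morphisms has length $n$. Then $A=\bigoplus_{n\ge0}A_n$ is a graded algebra, and it is quasi-Koszul: with $A_0$ regarded as the left $A$-module $A/\bigoplus_{n\ge1}A_n$, $$\operatorname{Ext}^1_A(A_0,A_0)\cdot\operatorname{Ext}^i_A(A_0,A_0)=\operatorname{Ext}^{i+1}_A(A_0,A_0)\qquad\text{for all } i\ge0,$$ where the left side is the set of finite sums of Yoneda products. -/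

import Mathlib

open CategoryTheory

/-! ### The category algebra -/

/-- A morphism of the category `E`, bundled with its source and target. -/
structure Mor (E : Type*) [Category E] where
  /-- the source -/
  src : E
  /-- the target -/
  tgt : E
  /-- the morphism itself -/
  hom : src ⟶ tgt

/-- The category algebra `k E`: the `k`-vector space with basis the morphisms of `E`. Its
multiplication is the bilinear extension of `β * α = β ∘ α` if the target of `α` is the source of
`β`, and `β * α = 0` otherwise. -/
def CatAlg (k E : Type*) [Category E] [Field k] : Type _ := Mor E →₀ k

namespace CatAlg

section Basic

variable (k : Type*) {E : Type*} [Category E] [Field k]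

noncomputable instance : AddCommGroup (CatAlg k E) := inferInstanceAs (AddCommGroup (Mor E →₀ k))

noncomputable instance : Module k (CatAlg k E) := inferInstanceAs (Module k (Mor E →₀ k))

/-- The basis vector of `k E` given by a morphism. -/
noncomputable def basisVec (m : Mor E) : CatAlg k E := Finsupp.single m (1 : k)

open Classical in
/-- The product `β * α` of two morphisms in `k E`: the composite "first `α`, then `β`" if they are
composable, and `0` otherwise. -/
noncomputable def mulMor (β α : Mor E) : CatAlg k E :=
  if h : α.tgt = β.src then basisVec k ⟨α.src, β.tgt, α.hom ≫ eqToHom h ≫ β.hom⟩ else 0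

/-- The linear extension to `k E` of a function on morphisms. -/
noncomputable def extend {V : Type*} [AddCommGroup V] [Module k V] (F : Mor E → V) :
    CatAlg k E →ₗ[k] V :=
  Finsupp.lift V k (Mor E) F

theorem extend_basisVec {V : Type*} [AddCommGroup V] [Module k V] (F : Mor E → V) (m : Mor E) :
    extend k F (basisVec k m) = F m :=
  (Finsupp.sum_single_index (h := fun m r => r • F m) (zero_smul k _)).trans (one_smul k _)

/-- The multiplication of `k E` as a bilinear map. -/
noncomputable def mulBilin : CatAlg k E →ₗ[k] CatAlg k E →ₗ[k] CatAlg k E :=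
  extend k (fun β => extend k (fun α => mulMor k β α))

variable {k}

noncomputable instance : Mul (CatAlg k E) := ⟨fun a b => mulBilin k a b⟩

theorem mul_def (a b : CatAlg k E) : a * b = mulBilin k a b := rfl

theorem basisVec_mul (β α : Mor E) : basisVec k β * basisVec k α = mulMor k β α := by
  rw [mul_def, mulBilin, extend_basisVec, extend_basisVec]

theorem basisVec_mul_comp {x y z : E} (f : x ⟶ y) (g : y ⟶ z) :
    basisVec k ⟨y, z, g⟩ * basisVec k ⟨x, y, f⟩ = basisVec k ⟨x, z, f ≫ g⟩ := by
  simp [basisVec_mul, mulMor]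

theorem basisVec_mul_of_ne {β α : Mor E} (h : α.tgt ≠ β.src) :
    basisVec k β * basisVec k α = 0 := by
  simp [basisVec_mul, mulMor, h]

/-- Linear maps out of `k E` that agree on the morphisms are equal. -/
theorem linearMap_ext {V : Type*} [AddCommGroup V] [Module k V] {f g : CatAlg k E →ₗ[k] V}
    (h : ∀ m, f (basisVec k m) = g (basisVec k m)) : f = g :=
  Finsupp.lhom_ext' fun m => LinearMap.ext_ring (h m)

theorem basisVec_mul_assoc (γ β α : Mor E) :
    basisVec k γ * basisVec k β * basisVec k α = basisVec k γ * (basisVec k β * basisVec k α) := by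
  obtain ⟨a, b, f⟩ := α
  obtain ⟨c, d, g⟩ := β
  obtain ⟨p, q, h⟩ := γ
  by_cases h1 : b = c
  · subst h1
    by_cases h2 : d = p
    · subst h2
      simp only [basisVec_mul_comp, Category.assoc]
    · rw [basisVec_mul_comp, basisVec_mul_of_ne (by exact h2), basisVec_mul_of_ne (by exact h2)]
      simp [mul_def]
  · rw [basisVec_mul_of_ne (β := ⟨c, d, g⟩) (α := ⟨a, b, f⟩) (by exact h1)]
    by_cases h2 : d = p
    · subst h2
      rw [basisVec_mul_comp, basisVec_mul_of_ne (by exact h1)]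
      simp [mul_def]
    · rw [basisVec_mul_of_ne (by exact h2)]
      simp [mul_def]

theorem mul_assoc' (a b c : CatAlg k E) : a * b * c = a * (b * c) := by
  have key : (LinearMap.llcomp k (CatAlg k E) (CatAlg k E) (CatAlg k E) ∘ₗ mulBilin k).compl₂
      (mulBilin k) = (mulBilin k).compr₂ (mulBilin k) := by
    refine linearMap_ext fun γ => linearMap_ext fun β => linearMap_ext fun α => ?_
    exact (basisVec_mul_assoc γ β α).symm
  exact (congr($key a b c)).symm

variable [Fintype E]

/-- The unit of `k E` is the sum of the identity morphisms. -/
noncomputable instance : One (CatAlg k E) := ⟨∑ x : E, basisVec k ⟨x, x, 𝟙 x⟩⟩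

theorem one_def : (1 : CatAlg k E) = ∑ x : E, basisVec k ⟨x, x, 𝟙 x⟩ := rfl

theorem one_mul' (a : CatAlg k E) : 1 * a = a := by
  have key : mulBilin k (1 : CatAlg k E) = LinearMap.id := by
    refine linearMap_ext fun α => ?_
    rw [one_def, map_sum, LinearMap.sum_apply, Finset.sum_eq_single α.tgt]
    · exact (basisVec_mul_comp α.hom (𝟙 _)).trans (by rw [Category.comp_id]; rfl)
    · exact fun x _ hx => basisVec_mul_of_ne (Ne.symm hx)
    · simp
  exact congr($key a)

theorem mul_one' (a : CatAlg k E) : a * 1 = a := by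
  have key : (mulBilin k).flip (1 : CatAlg k E) = LinearMap.id := by
    refine linearMap_ext fun α => ?_
    rw [one_def, map_sum, LinearMap.sum_apply, Finset.sum_eq_single α.src]
    · rw [LinearMap.flip_apply, ← mul_def, LinearMap.id_apply]
      exact (basisVec_mul_comp (𝟙 _) α.hom).trans (by rw [Category.id_comp])
    · intro x _ hx
      rw [LinearMap.flip_apply, ← mul_def]
      exact basisVec_mul_of_ne hx
    · simp
  exact congr($key a)

noncomputable instance : Ring (CatAlg k E) :=
  { (inferInstance : AddCommGroup (CatAlg k E)) with
    mul := (· * ·)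
    one := 1
    mul_assoc := mul_assoc'
    one_mul := one_mul'
    mul_one := mul_one'
    left_distrib := fun a b c => by simp [mul_def]
    right_distrib := fun a b c => by simp [mul_def]
    zero_mul := fun a => by simp [mul_def]
    mul_zero := fun a => by simp [mul_def] }

noncomputable instance : Algebra k (CatAlg k E) :=
  Algebra.ofModule (fun r a b => by simp [mul_def]) (fun r a b => by simp [mul_def])

end Basic

end CatAlg

/-! ### Finite free EI categories -/

section EI

variable {E : Type*} [Category E]

/-- Every endomorphism is an isomorphism. -/
def IsEI (E : Type*) [Category E] : Prop := ∀ (x : E) (f : x ⟶ x), IsIso f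

/-- `f` is unfactorizable: it is not an isomorphism, and whenever it is a composite of two
morphisms, one of the two is an isomorphism. (In a skeletal category the isomorphisms are exactly
the automorphisms.) -/
def Unfactorizable {x y : E} (f : x ⟶ y) : Prop :=
  ¬ IsIso f ∧ ∀ (z : E) (g : x ⟶ z) (h : z ⟶ y), g ≫ h = f → IsIso g ∨ IsIso h

/-- Chains of unfactorizable morphisms from `x` to `y`. -/
inductive UnfChain (x : E) : E → Type _
  | nil : UnfChain x x
  | cons {y z : E} (p : UnfChain x y) (f : y ⟶ z) (hf : Unfactorizable f) : UnfChain x z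

/-- The number of morphisms in a chain. -/
def UnfChain.length {x : E} : ∀ {y : E}, UnfChain x y → ℕ
  | _, .nil => 0
  | _, .cons p _ _ => p.length + 1

/-- The composite of a chain. -/
def UnfChain.comp {x : E} : ∀ {y : E}, UnfChain x y → (x ⟶ y)
  | _, .nil => 𝟙 x
  | _, .cons p f _ => p.comp ≫ f

/-- `UnfChain.Ladder p q h`: the chains `p` and `q` run through the same objects
`x = x₀, x₁, …, xₙ = y`, and there are automorphisms `h₀ = 1, h₁, …, hₙ = h` of these objects that
form a commutative ladder from `p` to `q`. -/
inductive UnfChain.Ladder {x : E} : ∀ {y : E}, UnfChain x y → UnfChain x y → Aut y → Prop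
  | nil : UnfChain.Ladder .nil .nil (Iso.refl x)
  | cons {y z : E} {p q : UnfChain x y} {h : Aut y} (hpq : UnfChain.Ladder p q h)
      {f g : y ⟶ z} (hf : Unfactorizable f) (hg : Unfactorizable g) (h' : Aut z)
      (comm : f ≫ h'.hom = h.hom ≫ g) : UnfChain.Ladder (.cons p f hf) (.cons q g hg) h'

/-- The unique factorization property: any two factorizations of a non-isomorphism into
unfactorizable morphisms run through the same objects (in particular have the same length) and are
related by a commutative ladder of automorphisms that begins and ends with an identity. -/
def UniqueFactorization (E : Type*) [Category E] : Prop :=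
  ∀ (x y : E) (p q : UnfChain x y), ¬ IsIso p.comp → p.comp = q.comp →
    UnfChain.Ladder p q (Iso.refl y)

/-- A skeletal category with finitely many morphisms in which all endomorphisms are isomorphisms
and which has the unique factorization property. -/
structure IsFiniteFreeEI (E : Type*) [Category E] : Prop where
  finite_obj : Finite E
  finite_hom : ∀ x y : E, Finite (x ⟶ y)
  skeletal : Skeletal E
  ei : IsEI E
  ufp : UniqueFactorization E

/-- The stabilizer of `α : z ⟶ x` in `Aut x`, which acts on morphisms with target `x` by
composition. -/
def stabTarget {z x : E} (α : z ⟶ x) : Subgroup (Aut x) where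
  carrier := {g | α ≫ g.hom = α}
  one_mem' := Category.comp_id α
  mul_mem' := fun {a b} ha hb => by
    have ha : α ≫ a.hom = α := ha
    have hb : α ≫ b.hom = α := hb
    change α ≫ (b.hom ≫ a.hom) = α
    rw [← Category.assoc, hb, ha]
  inv_mem' := fun {a} ha => by
    have ha : α ≫ a.hom = α := ha
    change α ≫ a.inv = α
    exact (Iso.comp_inv_eq (show x ≅ x from a)).2 ha.symm

/-- The stabilizer of `β : x ⟶ y` in `Aut x`, which acts on morphisms with source `x` by
composition. -/
def stabSource {x y : E} (β : x ⟶ y) : Subgroup (Aut x) where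
  carrier := {g | g.hom ≫ β = β}
  one_mem' := Category.id_comp β
  mul_mem' := fun {a b} ha hb => by
    have ha : a.hom ≫ β = β := ha
    have hb : b.hom ≫ β = β := hb
    change (b.hom ≫ a.hom) ≫ β = β
    rw [Category.assoc, ha, hb]
  inv_mem' := fun {a} ha => by
    have ha : a.hom ≫ β = β := ha
    change a.inv ≫ β = β
    exact (Iso.inv_comp_eq (show x ≅ x from a)).2 ha.symm

/-- `x` is left regular over `k`: for every morphism with target `x`, the order of its stabilizer
in `Aut x` is invertible in `k`. -/
def LeftRegular (k : Type*) [Field k] (x : E) : Prop :=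
  ∀ (z : E) (α : z ⟶ x), IsUnit (Nat.card (stabTarget α) : k)

/-- `x` is right regular over `k`: for every morphism with source `x`, the order of its stabilizer
in `Aut x` is invertible in `k`. -/
def RightRegular (k : Type*) [Field k] (x : E) : Prop :=
  ∀ (y : E) (β : x ⟶ y), IsUnit (Nat.card (stabSource β) : k)

/-- `f` has length `n`: either `n = 0` and `f` is an isomorphism, or `n > 0` and `f` is a composite
of `n` unfactorizable morphisms. -/
def HasLength {x y : E} (f : x ⟶ y) (n : ℕ) : Prop :=
  (n = 0 ∧ IsIso f) ∨ (0 < n ∧ ∃ p : UnfChain x y, p.length = n ∧ p.comp = f)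

/-- The length grading of `k E`: the degree `n` part is spanned by the morphisms of length `n`. -/
noncomputable def lengthGrading (k E : Type*) [Category E] [Field k] (n : ℕ) : Submodule k (CatAlg k E) :=
  Submodule.span k {a | ∃ (x y : E) (f : x ⟶ y), HasLength f n ∧ a = CatAlg.basisVec k ⟨x, y, f⟩}

end EI

/-! ### Quasi-Koszul graded algebras -/

section QuasiKoszul

universe w u

variable {k : Type w} {A : Type u} [Field k] [Ring A] [Algebra k A]
  (𝒜 : ℕ → Submodule k A) [GradedAlgebra 𝒜]

/-- The degree zero part `A₀` of a graded algebra as a left `A`-module, that is, the quotient of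
`A` by `⨁ i > 0, A i`. -/
noncomputable def degreeZeroModule : ModuleCat.{u} A :=
  ModuleCat.of A (A ⧸ ((HomogeneousIdeal.irrelevant 𝒜).toIdeal : Submodule A A))

/-- An `A`-module `M` is quasi-Koszul if `Ext¹(A₀, A₀) · Extⁱ(M, A₀) = Extⁱ⁺¹(M, A₀)` for all
`i ≥ 0`: every element of the right side is a sum of Yoneda products. -/
def IsQuasiKoszulModule (M : ModuleCat.{u} A) : Prop :=
  ∀ i : ℕ, AddSubgroup.closure
    {z : Abelian.Ext M (degreeZeroModule 𝒜) (i + 1) |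
      ∃ (a : Abelian.Ext M (degreeZeroModule 𝒜) i)
        (b : Abelian.Ext (degreeZeroModule 𝒜) (degreeZeroModule 𝒜) 1), z = a.comp b rfl} = ⊤

/-- A graded algebra `A` is quasi-Koszul if `A₀` is a quasi-Koszul `A`-module. -/
def IsQuasiKoszulAlgebra : Prop := IsQuasiKoszulModule 𝒜 (degreeZeroModule 𝒜)

end QuasiKoszul

/-! Let `J` be the span of the non-isomorphisms, so that `A₀ = A/J`. For `i = 0` the claim is `z =
1·z`. For `i ≥ 1` the target is zero: by dimension shifting along `0 → J → A → A/J → 0` it is enough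
that `Ext^{n+1}(J, A/J) = 0` for all `n ≥ 0` (`CatAlg.ext_nonIso_eq_zero`).

By freeness, a non-isomorphism factors as an unfactorizable `α` followed by some `β`, uniquely up to
an isomorphism of the middle object (`IsFiniteFreeEI.exists_iso_of_comp_eq`). An `A`-linear map out
of `J` therefore amounts to `Aut x`-equivariant values on the unfactorizable `α : z ⟶ x`, and
lifting it along a surjection `I → Q` becomes a problem at each `x` separately
(`CatAlg.exists_lift_nonIso`). At a left regular `x`, one averages over stabilizers. At a right
regular `x`, one uses an `Aut x`-equivariant section of `I → Q`.

Such sections come from Higman's criterion `HasUnitTrace` at the right regular objects. It holds for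
`A/J`, since `e_x(A/J)` is the regular module of `Aut x`, and for injective modules, since right
regularity gives a relative trace on `A` itself. If it holds for `Y` and `Y` embeds in an injective
`I`, then `I → I/Y` has equivariant sections and `I/Y` inherits the criterion. Induction along
cosyzygies then kills all `Ext^{n+1}(J, Y)`. -/

/-! ### Factorizations in finite free EI categories. -/

section EICategories

variable {E : Type*} [Category E]

namespace IsEI

/-- An inverse of `f ≫ g` gives a retraction `r` of `f`; the endomorphism `r ≫ f` is invertible by
EI, so `f` is also split epi. -/
theorem isIso_left (hE : IsEI E) {x y z : E} (f : x ⟶ y) (g : y ⟶ z) (h : IsIso (f ≫ g)) :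
    IsIso f := by
  have : IsIso ((g ≫ inv (f ≫ g)) ≫ f) := hE _ _
  have h1 : IsSplitMono f := ⟨⟨⟨g ≫ inv (f ≫ g), by rw [← Category.assoc, IsIso.hom_inv_id]⟩⟩⟩
  have h2 : IsSplitEpi f := ⟨⟨⟨inv ((g ≫ inv (f ≫ g)) ≫ f) ≫ g ≫ inv (f ≫ g), by
    rw [Category.assoc, IsIso.inv_hom_id]⟩⟩⟩
  exact isIso_of_mono_of_isSplitEpi f

theorem isIso_right (hE : IsEI E) {x y z : E} (f : x ⟶ y) (g : y ⟶ z) (h : IsIso (f ≫ g)) :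
    IsIso g := by
  have := hE.isIso_left f g h
  exact IsIso.of_isIso_comp_left f g

end IsEI

namespace Unfactorizable

theorem comp_isIso {x y z : E} {f : x ⟶ y} (hf : Unfactorizable f) (u : y ⟶ z) [IsIso u] :
    Unfactorizable (f ≫ u) := by
  refine ⟨fun h => hf.1 (IsIso.of_isIso_comp_right f u), fun w g h e => ?_⟩
  refine (hf.2 w g (h ≫ inv u) (by rw [← Category.assoc, e]; simp)).imp id fun (_ : IsIso _) => ?_
  exact IsIso.of_isIso_comp_right h (inv u)

theorem isIso_comp {x y z : E} {f : y ⟶ z} (hf : Unfactorizable f) (u : x ⟶ y) [IsIso u] :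
    Unfactorizable (u ≫ f) := by
  refine ⟨fun h => hf.1 (IsIso.of_isIso_comp_left u f), fun w g h e => ?_⟩
  refine (hf.2 w (inv u ≫ g) h (by rw [Category.assoc, e]; simp)).imp (fun (_ : IsIso _) => ?_) id
  exact IsIso.of_isIso_comp_left (inv u) g

end Unfactorizable

namespace UnfChain

/-- The chain consisting of one morphism. -/
def single {x y : E} (f : x ⟶ y) (hf : Unfactorizable f) : UnfChain x y := .cons .nil f hf

/-- Concatenation of chains. -/
def append {x y : E} (p : UnfChain x y) : ∀ {z : E}, UnfChain y z → UnfChain x z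
  | _, .nil => p
  | _, .cons q f hf => .cons (append p q) f hf

theorem comp_append {x y z : E} (p : UnfChain x y) (q : UnfChain y z) :
    (p.append q).comp = p.comp ≫ q.comp := by
  induction q with
  | nil => simp [append, comp]
  | cons q f hf ih => simp [append, comp, ih]

theorem length_append {x y z : E} (p : UnfChain x y) (q : UnfChain y z) :
    (p.append q).length = p.length + q.length := by
  induction q with
  | nil => simp [append, length]
  | cons q f hf ih => simp [append, length, ih, add_assoc]

theorem not_isIso_comp (hE : IsEI E) {x y : E} (p : UnfChain x y) (hp : 0 < p.length) :
    ¬ IsIso p.comp := by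
  cases p with
  | nil => simp [length] at hp
  | cons p f hf => exact fun h => hf.1 (hE.isIso_right _ _ h)

theorem Ladder.length_eq {x y : E} {p q : UnfChain x y} {h : Aut y} (H : Ladder p q h) :
    p.length = q.length := by
  induction H with
  | nil => rfl
  | cons _ _ _ _ _ ih => simp [length, ih]

theorem exists_comp_isIso {x y z : E} (p : UnfChain x y) (hp : 0 < p.length) (u : y ⟶ z)
    [IsIso u] : ∃ q : UnfChain x z, q.length = p.length ∧ q.comp = p.comp ≫ u := by
  cases p with
  | nil => simp [length] at hp
  | cons p f hf => exact ⟨.cons p (f ≫ u) (hf.comp_isIso u), rfl, by simp [comp]⟩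

theorem exists_isIso_comp {x y z : E} (u : x ⟶ y) [IsIso u] (p : UnfChain y z)
    (hp : 0 < p.length) :
    ∃ q : UnfChain x z, q.length = p.length ∧ q.comp = u ≫ p.comp := by
  induction p with
  | nil => simp [length] at hp
  | cons p f hf ih =>
    rcases Nat.eq_zero_or_pos p.length with h0 | h0
    · cases p with
      | nil => exact ⟨single (u ≫ f) (hf.isIso_comp u), rfl, by simp [single, comp]⟩
      | cons => simp [length] at h0
    · obtain ⟨q, hq, hq'⟩ := ih h0
      exact ⟨.cons q f hf, by simp [length, hq], by simp [comp, hq']⟩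

/-- Chains of positive length whose composites differ by an automorphism of the target are related
by a ladder ending with this automorphism. -/
theorem ladder_of_comp_eq (hE : IsEI E) (hU : UniqueFactorization E) {x y : E}
    (p q : UnfChain x y) (hp : 0 < p.length) (h : Aut y) (e : p.comp ≫ h.hom = q.comp) :
    Ladder p q h := by
  cases p with
  | nil => simp [length] at hp
  | cons p f hf =>
    have : IsIso h.hom := (show y ≅ y from h).isIso_hom
    -- Absorbing `h` into the last arrow makes the composites equal; only the last rung of the
    -- resulting ladder has to be changed back.
    have := hU _ _ (.cons p (f ≫ h.hom) (hf.comp_isIso _)) q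
      (not_isIso_comp hE _ (by simp [length])) (by rw [← e]; simp [comp])
    generalize hr : Iso.refl y = r at this
    cases this with
    | cons hpq _ hg _ comm =>
      subst hr
      refine .cons hpq hf hg h ?_
      rw [← comm]
      exact (Category.comp_id _).symm

/-- The isomorphism `g` is the rung after the first arrow; the squares above it compose to the
second equation. -/
theorem Ladder.exists_iso_of_append {x z z' y : E} {f : x ⟶ z} {hf : Unfactorizable f}
    {f' : x ⟶ z'} {hf' : Unfactorizable f'} {p : UnfChain z y} {p' : UnfChain z' y} {h : Aut y}
    (H : Ladder ((single f hf).append p) ((single f' hf').append p') h) :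
    ∃ g : z ≅ z', f ≫ g.hom = f' ∧ p.comp ≫ h.hom = g.hom ≫ p'.comp := by
  have hl := H.length_eq
  rw [length_append, length_append] at hl
  simp only [single, length] at hl
  induction p with
  | nil =>
    cases p' with
    | nil =>
      cases H with
      | cons hpq _ _ _ comm =>
        generalize hr : h = r at *
        cases hpq
        exact ⟨r, by rw [comm]; exact Category.id_comp _, by simp [comp]⟩
    | cons => simp [length] at hl
  | cons p a ha ih =>
    cases p' with
    | nil => simp [length] at hl
    | cons p' b hb =>
      cases H with
      | cons hpq _ _ _ comm =>
        obtain ⟨g, h1, h2⟩ := ih hpq (by simpa [length] using hl)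
        refine ⟨g, h1, ?_⟩
        simp only [comp, Category.assoc, comm]
        rw [← Category.assoc, h2, Category.assoc]

end UnfChain

open UnfChain in
theorem HasLength.comp {x y z : E} {f : x ⟶ y} {g : y ⟶ z} {m n : ℕ} (hf : HasLength f m)
    (hg : HasLength g n) : HasLength (f ≫ g) (m + n) := by
  rcases hf with ⟨rfl, hf⟩ | ⟨hm, p, rfl, rfl⟩ <;> rcases hg with ⟨rfl, hg⟩ | ⟨hn, q, rfl, rfl⟩
  · exact Or.inl ⟨rfl, inferInstance⟩
  · obtain ⟨r, h1, h2⟩ := exists_isIso_comp f q hn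
    exact Or.inr ⟨by omega, r, by omega, h2⟩
  · obtain ⟨r, h1, h2⟩ := exists_comp_isIso p hm g
    exact Or.inr ⟨by omega, r, by omega, h2⟩
  · exact Or.inr ⟨by omega, p.append q, length_append _ _, comp_append _ _⟩

namespace IsFiniteFreeEI

open UnfChain

theorem exists_chain (hE : IsFiniteFreeEI E) {x y : E} (f : x ⟶ y) (hf : ¬ IsIso f) :
    ∃ p : UnfChain x y, 0 < p.length ∧ p.comp = f := by
  have := hE.finite_obj
  -- Induction on the number of objects strictly between `x` and `y`. If `z` is one of them, it is
  -- not strictly between `x` and `z`, nor between `z` and `y`, since its endomorphisms are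
  -- invertible.
  let B (x y : E) : Set E := {z | (∃ g : x ⟶ z, ¬ IsIso g) ∧ ∃ h : z ⟶ y, ¬ IsIso h}
  have key : ∀ (n : ℕ) (x y : E) (f : x ⟶ y), ¬ IsIso f → (B x y).ncard = n →
      ∃ p : UnfChain x y, 0 < p.length ∧ p.comp = f := by
    intro n
    induction n using Nat.strong_induction_on with
    | _ n ih =>
      intro x y f hf hn
      by_cases hu : Unfactorizable f
      · exact ⟨single f hu, by simp [single, length], by simp [single, comp]⟩
      · simp only [Unfactorizable, hf, not_false_eq_true, true_and, not_forall, not_or] at hu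
        obtain ⟨z, g, h, e, hg, hh⟩ := hu
        have hz : z ∈ B x y := ⟨⟨g, hg⟩, ⟨h, hh⟩⟩
        have h1 : B x z ⊂ B x y := by
          refine ⟨fun w ⟨hw, a, ha⟩ => ⟨hw, a ≫ h, fun H => ha (hE.ei.isIso_left _ _ H)⟩, fun H => ?_⟩
          obtain ⟨-, a, ha⟩ := H hz
          exact ha (hE.ei _ a)
        have h2 : B z y ⊂ B x y := by
          refine ⟨fun w ⟨⟨a, ha⟩, hw⟩ => ⟨⟨g ≫ a, fun H => ha (hE.ei.isIso_right _ _ H)⟩, hw⟩,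
            fun H => ?_⟩
          obtain ⟨⟨a, ha⟩, -⟩ := H hz
          exact ha (hE.ei _ a)
        obtain ⟨p, hp, hp'⟩ := ih _ (hn ▸ Set.ncard_lt_ncard h1) x z g hg rfl
        obtain ⟨q, hq, hq'⟩ := ih _ (hn ▸ Set.ncard_lt_ncard h2) z y h hh rfl
        exact ⟨p.append q, by rw [length_append]; omega, by rw [comp_append, hp', hq', e]⟩
  exact key _ x y f hf rfl

theorem exists_hasLength (hE : IsFiniteFreeEI E) {x y : E} (f : x ⟶ y) : ∃ n, HasLength f n := by
  by_cases hf : IsIso f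
  · exact ⟨0, Or.inl ⟨rfl, hf⟩⟩
  · obtain ⟨p, hp, e⟩ := hE.exists_chain f hf
    exact ⟨p.length, Or.inr ⟨hp, p, rfl, e⟩⟩

theorem hasLength_unique (hE : IsFiniteFreeEI E) {x y : E} {f : x ⟶ y} {m n : ℕ} (hm : HasLength f m)
    (hn : HasLength f n) : m = n := by
  rcases hm with ⟨rfl, hm⟩ | ⟨hm, p, rfl, rfl⟩ <;> rcases hn with ⟨rfl, hn⟩ | ⟨hn, q, rfl, e⟩
  · rfl
  · exact absurd (e ▸ hm) (not_isIso_comp hE.ei q hn)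
  · exact absurd hn (not_isIso_comp hE.ei p hm)
  · exact (hE.ufp _ _ p q (not_isIso_comp hE.ei p hm) e.symm).length_eq

/-- In a finite free EI category, two factorizations of a morphism whose first factor is
unfactorizable differ by an isomorphism of the intermediate objects. -/
theorem exists_iso_of_comp_eq (hE : IsFiniteFreeEI E) {x z z' y : E} {α : x ⟶ z} (hα : Unfactorizable α) {α' : x ⟶ z'}
    (hα' : Unfactorizable α') {β : z ⟶ y} {β' : z' ⟶ y} (e : α ≫ β = α' ≫ β') :
    ∃ g : z ≅ z', α ≫ g.hom = α' ∧ β = g.hom ≫ β' := by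
  have key : ∀ {w : E} (b : w ⟶ y), ∃ (p : UnfChain w y) (u : Aut y), b = p.comp ≫ u.hom := by
    intro w b
    by_cases hb : IsIso b
    · obtain rfl : w = y := hE.skeletal ⟨asIso b⟩
      exact ⟨.nil, asIso b, by simp [comp]⟩
    · obtain ⟨p, -, hp⟩ := hE.exists_chain b hb
      exact ⟨p, Iso.refl y, by simp [hp]⟩
  obtain ⟨p, u, rfl⟩ := key β
  obtain ⟨p', u', rfl⟩ := key β'
  -- `β` and `β'` are composites of chains only up to automorphisms `u`, `u'` of `y` (the chain is
  -- empty for an isomorphism); `t` is the discrepancy, placed at the end of the ladder.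
  let t : y ≅ y := u ≪≫ u'.symm
  have ht : t.hom = u.hom ≫ u'.inv := rfl
  have H := ladder_of_comp_eq hE.ei hE.ufp ((single α hα).append p) ((single α' hα').append p')
    (by rw [length_append]; simp [single, length]) t (by
      rw [comp_append, comp_append]
      have := congr($e ≫ u'.inv)
      simp only [Category.assoc, Iso.hom_inv_id u', Category.comp_id] at this
      simpa [single, comp, ht] using this)
  obtain ⟨g, h1, h2⟩ := H.exists_iso_of_append
  refine ⟨g, h1, ?_⟩
  have := congr($h2 ≫ u'.hom)
  rw [ht] at this
  simpa only [Category.assoc, Iso.inv_hom_id u', Category.comp_id] using this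

theorem exists_unfactorizable_comp (hE : IsFiniteFreeEI E) {x y : E} (f : x ⟶ y) (hf : ¬ IsIso f) :
    ∃ (z : E) (α : x ⟶ z) (β : z ⟶ y), Unfactorizable α ∧ α ≫ β = f := by
  obtain ⟨p, hp, rfl⟩ := hE.exists_chain f hf
  clear hf
  induction p with
  | nil => simp [length] at hp
  | cons p a ha ih =>
    rcases Nat.eq_zero_or_pos p.length with h0 | h0
    · cases p with
      | nil => exact ⟨_, a, 𝟙 _, ha, by simp [comp]⟩
      | cons => simp [length] at h0
    · obtain ⟨z, α, β, hα, e⟩ := ih h0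
      exact ⟨z, α, β ≫ a, hα, by simp [comp, ← e]⟩

end IsFiniteFreeEI

end EICategories

/-! ### Relative traces and Higman's criterion. -/

section RelativeTrace

variable {G A : Type*} [Group G] [Fintype G] [Ring A]

/-- The relative trace `∑ g, g ∘ φ ∘ g⁻¹` of an additive map, for a group acting through a
(not necessarily unital) multiplicative map `ι : G → A`. -/
def relTrace (ι : G →ₙ* A) {M N : Type*} [AddCommGroup M] [Module A M] [AddCommGroup N]
    [Module A N] (φ : M →+ N) : M →+ N where
  toFun m := ∑ g, ι g • φ (ι g⁻¹ • m)
  map_zero' := by simp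
  map_add' := by simp [Finset.sum_add_distrib]

/-- Higman's criterion: `ι 1` acts on `M` as the relative trace of an additive endomorphism. -/
def HasUnitTrace (ι : G →ₙ* A) (M : Type*) [AddCommGroup M] [Module A M] : Prop :=
  ∃ θ : M →+ M, ∀ m, relTrace ι θ m = ι 1 • m

variable {ι : G →ₙ* A} {M N Y I Q : Type*} [AddCommGroup M] [Module A M] [AddCommGroup N]
  [Module A N] [AddCommGroup Y] [Module A Y] [AddCommGroup I] [Module A I]
  [AddCommGroup Q] [Module A Q]

theorem relTrace_apply (φ : M →+ N) (m : M) :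
    relTrace ι φ m = ∑ g, ι g • φ (ι g⁻¹ • m) := rfl

theorem relTrace_smul (φ : M →+ N) (h : G) (m : M) :
    relTrace ι φ (ι h • m) = ι h • relTrace ι φ m := by
  rw [relTrace_apply, relTrace_apply, Finset.smul_sum]
  refine (Fintype.sum_equiv (Equiv.mulLeft h) _ _ fun g => ?_).symm
  simp [smul_smul, ← map_mul]

/-- If the submodule in a short exact sequence satisfies Higman's criterion, then the sequence has
an equivariant section. -/
theorem HasUnitTrace.exists_section (hY : HasUnitTrace ι Y) (j : Y →ₗ[A] I) (p : I →ₗ[A] Q)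
    (hjp : Function.Exact j p) (hp : Function.Surjective p) (ρ : I →+ Y) (hρ : ∀ y, ρ (j y) = y) :
    ∃ s : Q →+ I, (∀ g q, s (ι g • q) = ι g • s q) ∧ ∀ q, p (s q) = ι 1 • q := by
  obtain ⟨θ, hθ⟩ := hY
  -- Tracing `θ ∘ ρ` turns the additive retraction into an equivariant one, with `ρ' ∘ j = ι 1`.
  -- Then `ι 1 - j ∘ ρ'` vanishes on the image of `j` and descends to the section.
  let ρ' : I →+ Y := relTrace ι (θ.comp ρ)
  have hρ' : ∀ y, ρ' (j y) = ι 1 • y := fun y => by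
    rw [← hθ]
    simp only [ρ', relTrace_apply, ← map_smul, AddMonoidHom.comp_apply, hρ]
  have hpj : ∀ y, p (j y) = 0 := fun y => (hjp _).2 ⟨y, rfl⟩
  let σ : I →+ I := DistribSMul.toAddMonoidHom I (ι 1) - j.toAddMonoidHom.comp ρ'
  have hσ : ∀ m, σ m = ι 1 • m - j (ρ' m) := fun m => rfl
  have hσ0 : ∀ m m', p m = p m' → σ m = σ m' := fun m m' h => by
    obtain ⟨y, hy⟩ := (hjp (m - m')).1 (by rw [map_sub, h, sub_self])
    rw [← sub_eq_zero, ← map_sub, ← hy, hσ, hρ', map_smul, sub_self]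
  let c := Function.surjInv hp
  have hc : ∀ q, p (c q) = q := Function.surjInv_eq hp
  have hs : ∀ m, σ (c (p m)) = σ m := fun m => hσ0 _ _ (hc _)
  refine ⟨⟨⟨fun q => σ (c q), by rw [← map_zero p, hs, map_zero]⟩, fun a b => ?_⟩,
    fun g q => ?_, fun q => ?_⟩
  · obtain ⟨a, rfl⟩ := hp a
    obtain ⟨b, rfl⟩ := hp b
    simp only [← map_add p, hs, map_add σ]
  · obtain ⟨m, rfl⟩ := hp q
    change σ (c (ι g • p m)) = ι g • σ (c (p m))
    rw [← map_smul, hs, hs, hσ, hσ, relTrace_smul, map_smul, smul_sub, smul_smul, smul_smul,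
      ← map_mul, ← map_mul, one_mul, mul_one]
  · change p (σ (c q)) = _
    rw [hσ, map_sub, hpj, sub_zero, map_smul, hc]

/-- The criterion passes to equivariant retracts: conjugate `θ` to `p ∘ θ ∘ s`. -/
theorem HasUnitTrace.of_section (hI : HasUnitTrace ι I) (p : I →ₗ[A] Q) (s : Q →+ I)
    (hs : ∀ g q, s (ι g • q) = ι g • s q) (hps : ∀ q, p (s q) = ι 1 • q) : HasUnitTrace ι Q := by
  obtain ⟨θ, hθ⟩ := hI
  refine ⟨p.toAddMonoidHom.comp (θ.comp s), fun q => ?_⟩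
  have := congr(p $(hθ (s q)))
  rw [map_smul, hps, smul_smul, ← map_mul, one_mul] at this
  rw [← this, relTrace_apply, relTrace_apply, map_sum]
  simp [hs]

/-- The module coinduced from the additive group `M` along `ℤ → A`. -/
def Coinduced (A M : Type*) [Ring A] [AddCommGroup M] := A →+ M

namespace Coinduced

instance : AddCommGroup (Coinduced A M) := inferInstanceAs (AddCommGroup (A →+ M))

instance : Module A (Coinduced A M) where
  smul a φ := AddMonoidHom.comp φ (AddMonoidHom.mulRight a)
  one_smul φ := AddMonoidHom.ext fun b => congrArg φ.toFun (mul_one b)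
  mul_smul a a' φ := AddMonoidHom.ext fun b => congrArg φ.toFun (mul_assoc b a a').symm
  smul_zero _ := rfl
  smul_add _ _ _ := rfl
  add_smul a a' φ := AddMonoidHom.ext fun b =>
    (congrArg φ.toFun (mul_add b a a')).trans (AddMonoidHom.map_add φ _ _)
  zero_smul φ := AddMonoidHom.ext fun b =>
    (congrArg φ.toFun (mul_zero b)).trans (AddMonoidHom.map_zero φ)

/-- The embedding of a module into the coinduced module. -/
def unit (A M : Type*) [Ring A] [AddCommGroup M] [Module A M] : M →ₗ[A] Coinduced A M where
  toFun m := (AddMonoidHom.flip (smulAddHom A M)) m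
  map_add' := map_add _
  map_smul' a m := AddMonoidHom.ext fun b => smul_smul b a m

theorem unit_injective : Function.Injective (unit A M) := fun m m' h => by
  have : (1 : A) • m = (1 : A) • m' := congrArg (fun φ : A →+ M => φ 1) h
  simpa using this

/-- Since `A` acts on functions through right multiplication on their argument, precomposition with
`τ` turns a trace for the right action on `A` into one for the left action on functions. -/
theorem hasUnitTrace {M : Type*} [AddCommGroup M] (τ : A →+ A) (hτ : ∀ a, ∑ g, τ (a * ι g) * ι g⁻¹ = a * ι 1) :
    HasUnitTrace ι (Coinduced A M) := by
  let θ : Coinduced A M →+ Coinduced A M :=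
    ⟨⟨fun φ => AddMonoidHom.comp φ τ, rfl⟩, fun _ _ => rfl⟩
  refine ⟨θ, fun φ => AddMonoidHom.ext fun b => ?_⟩
  let ev : Coinduced A M →+ M := ⟨⟨fun ψ => ψ.toFun b, rfl⟩, fun _ _ => rfl⟩
  let φ' : A →+ M := φ
  have h1 : ev (relTrace ι θ φ) = ∑ g, φ' (τ (b * ι g) * ι g⁻¹) := by
    rw [relTrace_apply, map_sum]
    rfl
  change ev (relTrace ι θ φ) = φ' (b * ι 1)
  rw [h1, ← map_sum, hτ]

end Coinduced

/-- `hM` holds for injective modules; it makes `M` a direct summand of its coinduced module. -/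
theorem HasUnitTrace.of_injective {A : Type*} [Ring A] {ι : G →ₙ* A} {M : Type*} [AddCommGroup M]
    [Module A M]
    (hM : ∀ r : M →ₗ[A] Coinduced A M, Function.Injective r →
      ∃ s : Coinduced A M →ₗ[A] M, ∀ m, s (r m) = m)
    (τ : A →+ A) (hτ : ∀ a, ∑ g, τ (a * ι g) * ι g⁻¹ = a * ι 1) : HasUnitTrace ι M := by
  obtain ⟨s, hs⟩ := hM (Coinduced.unit A M) Coinduced.unit_injective
  obtain ⟨θ, hθ⟩ := Coinduced.hasUnitTrace (M := M) τ hτ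
  refine ⟨s.toAddMonoidHom.comp (θ.comp (Coinduced.unit A M).toAddMonoidHom), fun m => ?_⟩
  have := congr(s $(hθ (Coinduced.unit A M m)))
  rw [map_smul, hs] at this
  rw [← this, relTrace_apply, relTrace_apply, map_sum]
  simp

end RelativeTrace

/-! ### Equivariant lifting by averaging over stabilizers. -/

section OrbitAverage

variable {G X : Type*} [Group G] [MulAction G X]

variable (G) in
/-- A chosen representative of the orbit of `a`. -/
noncomputable def orbitRep (a : X) : X :=
  (Quotient.mk (MulAction.orbitRel G X) a).out

theorem orbitRep_smul (g : G) (a : X) : orbitRep G (g • a) = orbitRep G a := by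
  have : Quotient.mk (MulAction.orbitRel G X) (g • a) = Quotient.mk (MulAction.orbitRel G X) a :=
    Quotient.sound ⟨g, rfl⟩
  rw [orbitRep, this, orbitRep]

theorem exists_smul_orbitRep (a : X) : ∃ g : G, g • orbitRep G a = a := by
  obtain ⟨g, hg⟩ : (MulAction.orbitRel G X).r a (orbitRep G a) :=
    (MulAction.orbitRel G X).symm (Quotient.mk_out (s := MulAction.orbitRel G X) a)
  exact ⟨g, hg⟩

theorem card_smul_eq [Fintype G] [DecidableEq X] {a b : X} (h : ∃ g : G, g • b = a) :
    (Finset.univ.filter fun g : G => g • b = a).card = Nat.card (MulAction.stabilizer G b) := by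
  classical
  obtain ⟨g, rfl⟩ := h
  rw [Nat.card_eq_fintype_card, Fintype.card_subtype]
  refine Finset.card_equiv (Equiv.mulLeft g⁻¹) fun i => ?_
  simp [mul_smul, inv_smul_eq_iff]

/-- An equivariant map from a `G`-set whose stabilizers have invertible orders lifts along
surjections of modules. -/
theorem exists_equivariant_lift {k A I Q : Type*} [Field k] [Ring A] [Algebra k A] [Finite G]
    (ι : G →ₙ* A) [AddCommGroup I] [Module A I] [AddCommGroup Q] [Module A Q] (p : I →ₗ[A] Q)
    (hp : Function.Surjective p)
    (hG : ∀ a : X, IsUnit (Nat.card (MulAction.stabilizer G a) : k)) (f : X → Q)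
    (hf : ∀ (g : G) a, f (g • a) = ι g • f a) :
    ∃ φ : X → I, (∀ a, p (φ a) = f a) ∧ ∀ (g : G) a, φ (g • a) = ι g • φ a := by
  classical
  have := Fintype.ofFinite G
  let y (a : X) : I := Function.surjInv hp (f a)
  have hy : ∀ a, p (y a) = f a := fun a => Function.surjInv_eq hp _
  -- The elements carrying the representative to `a` form a coset of its stabilizer, so `c a` turns
  -- the sum over them into an average. Being a scalar, it commutes with `ι g`.
  let c (a : X) : A := algebraMap k A (Nat.card (MulAction.stabilizer G (orbitRep G a)) : k)⁻¹
  refine ⟨fun a => c a • ∑ h : G, if h • orbitRep G a = a then ι h • y (orbitRep G a) else 0,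
    fun a => ?_, fun g a => ?_⟩
  · have : ∀ h : G, p (if h • orbitRep G a = a then ι h • y (orbitRep G a) else 0) =
        if h • orbitRep G a = a then f a else 0 := fun h => by
      split_ifs with e
      · rw [map_smul, hy, ← hf, e]
      · exact map_zero p
    rw [map_smul, map_sum, Finset.sum_congr rfl fun h _ => this h, Finset.sum_ite,
      Finset.sum_const_zero, add_zero, Finset.sum_const, card_smul_eq (exists_smul_orbitRep a),
      ← Nat.cast_smul_eq_nsmul A, smul_smul, ← map_natCast (algebraMap k A), ← map_mul,
      inv_mul_cancel₀ (hG _).ne_zero, map_one, one_smul]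
  · have hc : ι g * c a = c a * ι g := (Algebra.commutes _ _).symm
    simp only [c, orbitRep_smul] at hc ⊢
    rw [smul_smul, hc, mul_smul, Finset.smul_sum (r := ι g)]
    refine congrArg _ (Eq.symm ?_)
    refine Fintype.sum_equiv (Equiv.mulLeft g) _ _ fun h => ?_
    simp [mul_smul, map_mul]

end OrbitAverage

/-! ### Traces at right regular objects, and lifting maps out of the non-isomorphisms. -/

namespace CatAlg

variable {k E : Type*} [Field k] [Category E]

/-- The span of the non-isomorphisms in the category algebra. -/
noncomputable def nonIsoSpan (k E : Type*) [Field k] [Category E] : Submodule k (CatAlg k E) :=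
  Submodule.span k {a | ∃ m : Mor E, ¬ IsIso m.hom ∧ a = basisVec k m}

variable (k) in
/-- The inclusion of an automorphism group into the category algebra. -/
noncomputable def autHom (x : E) : Aut x →ₙ* CatAlg k E where
  toFun g := basisVec k ⟨x, x, g.hom⟩
  map_mul' g h := (basisVec_mul_comp h.hom g.hom).symm

theorem autHom_mul {x y : E} (g : Aut y) (f : x ⟶ y) :
    autHom k y g * basisVec k ⟨x, y, f⟩ = basisVec k ⟨x, y, f ≫ g.hom⟩ :=
  basisVec_mul_comp f g.hom

theorem mul_autHom {x y : E} (g : Aut x) (f : x ⟶ y) :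
    basisVec k ⟨x, y, f⟩ * autHom k x g = basisVec k ⟨x, y, g.hom ≫ f⟩ :=
  basisVec_mul_comp g.hom f

/-- The action of the automorphisms of the target on morphisms. -/
@[reducible] def autTargetAction (z x : E) : MulAction (Aut x) (z ⟶ x) where
  smul g α := α ≫ g.hom
  one_smul α := Category.comp_id α
  mul_smul g h α := (Category.assoc α h.hom g.hom).symm

/-- The action of the automorphisms of the source on morphisms. -/
@[reducible] def autSourceAction (x y : E) : MulAction (Aut x) (x ⟶ y) where
  smul g β := g.inv ≫ β
  one_smul β := Category.id_comp β
  mul_smul g h β := Category.assoc g.inv h.inv β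

theorem stabilizer_autSourceAction {x y : E} (β : x ⟶ y) :
    @MulAction.stabilizer (Aut x) _ _ (autSourceAction x y) β = stabSource β := by
  let := autSourceAction x y
  ext g
  rw [← inv_mem_iff]
  exact Iff.rfl

variable [Fintype E]

/-- At a right regular object `x`, the right multiplication by the identity of `x` is a relative
trace of an endomorphism of the category algebra. -/
theorem exists_trace_of_rightRegular {x : E} [Fintype (Aut x)] (hx : RightRegular k x) :
    ∃ τ : CatAlg k E →+ CatAlg k E,
      ∀ a, ∑ g, τ (a * autHom k x g) * autHom k x g⁻¹ = a * autHom k x 1 := by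
  classical
  let act (y : E) := autSourceAction x y
  let c {y : E} (β : x ⟶ y) : k := (Nat.card (MulAction.stabilizer (Aut x) β) : k)⁻¹
  -- `τ` keeps only the orbit representatives among morphisms with source `x`, divided by the order
  -- of their stabilizers. In the trace at `β`, each `g` carrying the representative to `β`
  -- contributes `c • β`, and there are as many such `g` as stabilizer elements.
  let τ : CatAlg k E →ₗ[k] CatAlg k E := extend k fun m =>
    if h : m.src = x then
      if orbitRep (Aut x) (eqToHom h.symm ≫ m.hom : x ⟶ m.tgt) = eqToHom h.symm ≫ m.hom then
        c (eqToHom h.symm ≫ m.hom) • basisVec k m else 0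
    else 0
  have hτ : ∀ {y : E} (β : x ⟶ y), τ (basisVec k ⟨x, y, β⟩) =
      if orbitRep (Aut x) β = β then c β • basisVec k ⟨x, y, β⟩ else 0 := fun β => by
    simp only [τ, extend_basisVec, dite_true, eqToHom_refl, Category.id_comp]
  refine ⟨τ.toAddMonoidHom, fun a => ?_⟩
  have key : ∑ g, (LinearMap.mulRight k (autHom k x g⁻¹)) ∘ₗ τ ∘ₗ
      (LinearMap.mulRight k (autHom k x g)) = LinearMap.mulRight k (autHom k x 1) := by
    refine linearMap_ext fun m => ?_
    obtain ⟨z, y, β⟩ := m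
    by_cases hz : z = x
    · subst hz
      rw [LinearMap.sum_apply]
      have hterm : ∀ g : Aut z, (LinearMap.mulRight k (autHom k z g⁻¹) ∘ₗ τ ∘ₗ
          LinearMap.mulRight k (autHom k z g)) (basisVec k ⟨z, y, β⟩) =
          if g • orbitRep (Aut z) β = β then
            c (orbitRep (Aut z) β) • basisVec k ⟨z, y, β⟩ else 0 := fun g => by
        simp only [LinearMap.comp_apply, LinearMap.mulRight_apply]
        have e : g.hom ≫ β = g⁻¹ • β := rfl
        rw [mul_autHom, e, hτ, orbitRep_smul]
        by_cases h : g • orbitRep (Aut z) β = β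
        · have h' : orbitRep (Aut z) β = g⁻¹ • β := eq_inv_smul_iff.2 h
          rw [if_pos h, if_pos h', ← h', smul_mul_assoc, mul_autHom]
          congr 4
        · have h' : ¬ orbitRep (Aut z) β = g⁻¹ • β := fun h' => h (eq_inv_smul_iff.1 h')
          rw [if_neg h, if_neg h', zero_mul]
      rw [Finset.sum_congr rfl fun g _ => hterm g, Finset.sum_ite, Finset.sum_const_zero, add_zero,
        Finset.sum_const, card_smul_eq (exists_smul_orbitRep β), ← Nat.cast_smul_eq_nsmul k,
        smul_smul, mul_inv_cancel₀, one_smul, LinearMap.mulRight_apply, mul_autHom]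
      · congr 2
        exact (Category.id_comp β).symm
      · rw [stabilizer_autSourceAction]
        exact (hx _ _).ne_zero
    · have h0 : ∀ g : Aut x, basisVec k ⟨z, y, β⟩ * autHom k x g = 0 := fun g =>
        basisVec_mul_of_ne fun h => hz h.symm
      simp [LinearMap.sum_apply, h0]
  have := congr($key a)
  simpa [LinearMap.sum_apply] using this

/-- The submodule of the category algebra spanned by the non-isomorphisms has the lifting property
with respect to surjections with equivariant sections at the right regular objects. -/
theorem exists_lift_nonIso (hE : IsFiniteFreeEI E)
    (hreg : ∀ x : E, LeftRegular k x ∨ RightRegular k x) (J : Submodule (CatAlg k E) (CatAlg k E))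
    (hJ : ∀ a, a ∈ J ↔ a ∈ nonIsoSpan k E) {I Q : Type*} [AddCommGroup I] [Module (CatAlg k E) I]
    [AddCommGroup Q] [Module (CatAlg k E) Q] (p : I →ₗ[CatAlg k E] Q)
    (hp : Function.Surjective p)
    (hs : ∀ x : E, RightRegular k x → ∃ s : Q →+ I,
      (∀ g q, s (autHom k x g • q) = autHom k x g • s q) ∧ ∀ q, p (s q) = autHom k x 1 • q)
    (f : J →ₗ[CatAlg k E] Q) : ∃ F : J →ₗ[CatAlg k E] I, ∀ j, p (F j) = f j := by
  classical
  let : Module k I := Module.compHom I (algebraMap k (CatAlg k E))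
  let : Module k Q := Module.compHom Q (algebraMap k (CatAlg k E))
  have : IsScalarTower k (CatAlg k E) I := IsScalarTower.of_algebraMap_smul fun _ _ => rfl
  have : IsScalarTower k (CatAlg k E) Q := IsScalarTower.of_algebraMap_smul fun _ _ => rfl
  have hmem : ∀ m : Mor E, ¬ IsIso m.hom → basisVec k m ∈ J := fun m hm =>
    (hJ _).2 (Submodule.subset_span ⟨m, hm, rfl⟩)
  -- The value 0 at isomorphisms keeps `f'` equivariant on all of `z ⟶ x`, because composing with
  -- automorphisms preserves isomorphisms and non-isomorphisms.
  let f' (m : Mor E) : Q := if h : ¬ IsIso m.hom then f ⟨basisVec k m, hmem m h⟩ else 0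
  have hf' : ∀ {z x w : E} (α : z ⟶ x) (β : x ⟶ w), ¬ IsIso α →
      f' ⟨z, w, α ≫ β⟩ = basisVec k ⟨x, w, β⟩ • f' ⟨z, x, α⟩ := fun {z x w} α β hα => by
    have h : ¬ IsIso (α ≫ β) := fun h => hα (hE.ei.isIso_left _ _ h)
    simp only [f', hα, h, not_false_eq_true, dite_true]
    rw [← map_smul]
    congr 1
    exact Subtype.ext (basisVec_mul_comp α β).symm
  have hf'aut : ∀ {z x : E} (α : z ⟶ x) (g : Aut x),
      f' ⟨z, x, α ≫ g.hom⟩ = autHom k x g • f' ⟨z, x, α⟩ := fun {z x} α g => by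
    by_cases hα : IsIso α
    · have : IsIso g.hom := hE.ei _ _
      have : IsIso (α ≫ g.hom) := IsIso.comp_isIso
      simp [f', hα, this]
    · exact hf' α g.hom hα
  have hφ : ∀ z x : E, ∃ φ : (z ⟶ x) → I, (∀ α, p (φ α) = f' ⟨z, x, α⟩) ∧
      ∀ (g : Aut x) α, φ (α ≫ g.hom) = autHom k x g • φ α := by
    intro z x
    rcases hreg x with hx | hx
    · let := autTargetAction z x
      have : Finite (Aut x) := by
        have := hE.finite_hom x x
        exact Finite.of_injective (fun g : Aut x => g.hom) fun g h e => Iso.ext e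
      exact exists_equivariant_lift (k := k) (autHom k x) p hp (hx z) (fun α => f' ⟨z, x, α⟩)
        fun g α => hf'aut α g
    · obtain ⟨s, hs1, hs2⟩ := hs x hx
      refine ⟨fun α => s (f' ⟨z, x, α⟩), fun α => ?_, fun g α => ?_⟩
      · rw [hs2, ← hf'aut]
        congr 2
        exact Category.comp_id α
      · exact (congrArg s (hf'aut α g)).trans (hs1 _ _)
  choose φ hφp hφg using hφ
  have hfac : ∀ m : Mor E, ¬ IsIso m.hom → ∃ (z : E) (α : m.src ⟶ z) (β : z ⟶ m.tgt),
      Unfactorizable α ∧ α ≫ β = m.hom := fun m hm => hE.exists_unfactorizable_comp m.hom hm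
  choose mid fst snd hfst hfac using hfac
  -- The lift sends `α ≫ β` to `β • φ α` for a chosen factorization. Equivariance of `φ` makes the
  -- choice irrelevant, as an isomorphism of middle objects can be moved across; this gives `hF'`
  -- and then linearity.
  let F' : CatAlg k E →ₗ[k] I := extend k fun m =>
    if h : ¬ IsIso m.hom then basisVec k ⟨_, _, snd m h⟩ • φ _ _ (fst m h) else 0
  have hF' : ∀ {z x w : E} (α : z ⟶ x) (β : x ⟶ w), Unfactorizable α →
      F' (basisVec k ⟨z, w, α ≫ β⟩) = basisVec k ⟨x, w, β⟩ • φ z x α := fun {z x w} α β hα => by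
    have h : ¬ IsIso (α ≫ β) := fun h => hα.1 (hE.ei.isIso_left _ _ h)
    simp only [F', extend_basisVec, h, not_false_eq_true, dite_true]
    obtain ⟨g, h1, h2⟩ := hE.exists_iso_of_comp_eq hα (hfst ⟨z, w, α ≫ β⟩ h)
      (β := β) (β' := snd ⟨z, w, α ≫ β⟩ h) (hfac ⟨z, w, α ≫ β⟩ h).symm
    have key : ∀ {x' : E} (α' : z ⟶ x') (β' : x' ⟶ w) (g : x ≅ x'), α ≫ g.hom = α' →
        β = g.hom ≫ β' → basisVec k ⟨x', w, β'⟩ • φ z x' α' = basisVec k ⟨x, w, β⟩ • φ z x α := by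
      intro x' α' β' g h1 h2
      obtain rfl : x = x' := hE.skeletal ⟨g⟩
      rw [← h1, h2]
      let t : Aut x := g
      exact (congrArg _ (hφg z x t α)).trans (by rw [smul_smul, mul_autHom])
    exact key _ _ g h1 h2
  have hF'mul : ∀ a, ∀ j ∈ nonIsoSpan k E, F' (a * j) = a • F' j := by
    intro a j hj
    induction hj using Submodule.span_induction with
    | zero => simp
    | add u v _ _ hu hv => rw [mul_add, map_add, map_add, hu, hv, smul_add]
    | smul c u _ hu => rw [mul_smul_comm, map_smul, map_smul, hu, smul_comm]
    | mem u hu =>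
      obtain ⟨⟨x, y, m⟩, hm, rfl⟩ := hu
      obtain ⟨z, α, β, hα, rfl⟩ := hE.exists_unfactorizable_comp m hm
      have key : F' ∘ₗ LinearMap.mulRight k (basisVec k ⟨x, y, α ≫ β⟩) =
          (LinearMap.toSpanSingleton (CatAlg k E) I
            (F' (basisVec k ⟨x, y, α ≫ β⟩))).restrictScalars k := by
        refine linearMap_ext fun n => ?_
        obtain ⟨y', w, γ⟩ := n
        simp only [LinearMap.comp_apply, LinearMap.mulRight_apply, LinearMap.coe_restrictScalars,
          LinearMap.toSpanSingleton_apply]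
        rw [hF' α β hα, smul_smul]
        by_cases hy : y = y'
        · subst hy
          rw [basisVec_mul_comp, basisVec_mul_comp, Category.assoc, hF' _ _ hα]
        · rw [basisVec_mul_of_ne (by exact hy), basisVec_mul_of_ne (by exact hy), map_zero,
            zero_smul]
      exact congr($key a)
  refine ⟨⟨⟨fun j => F' j, fun i j => map_add F' _ _⟩, fun a j => hF'mul a j ((hJ _).1 j.2)⟩,
    fun j => ?_⟩
  obtain ⟨j, hj⟩ := j
  change p (F' j) = _
  induction (hJ j).1 hj using Submodule.span_induction with
  | zero =>
    rw [map_zero, map_zero]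
    exact (map_zero f).symm
  | add u v hu hv hu' hv' =>
    rw [map_add, map_add, hu' ((hJ _).2 hu), hv' ((hJ _).2 hv), ← map_add]
    rfl
  | smul c u hu hu' =>
    rw [map_smul, LinearMap.map_smul_of_tower, hu' ((hJ _).2 hu), ← algebraMap_smul (CatAlg k E) c,
      ← map_smul]
    congr 1
    exact Subtype.ext (algebraMap_smul (CatAlg k E) c u)
  | mem u hu =>
    obtain ⟨⟨x, y, m⟩, hm, rfl⟩ := hu
    obtain ⟨z, α, β, hα, rfl⟩ := hE.exists_unfactorizable_comp m hm
    rw [hF' α β hα, map_smul, hφp, ← hf' α β hα.1]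
    simp only [f', hm, not_false_eq_true, dite_true]

end CatAlg

/-! ### The length grading and its degree zero part. -/

namespace CatAlg

variable {k E : Type*} [Field k] [Category E] [Fintype E]

theorem basisVec_mem_lengthGrading {x y : E} {f : x ⟶ y} {n : ℕ} (h : HasLength f n) :
    basisVec k ⟨x, y, f⟩ ∈ lengthGrading k E n :=
  Submodule.subset_span ⟨x, y, f, h, rfl⟩

theorem gradedMonoid_lengthGrading : SetLike.GradedMonoid (lengthGrading k E) where
  one_mem := Submodule.sum_mem _ fun _ _ =>
    basisVec_mem_lengthGrading (Or.inl ⟨rfl, inferInstance⟩)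
  mul_mem := fun m n a b ha hb => by
    have h : lengthGrading k E m * lengthGrading k E n ≤ lengthGrading k E (m + n) := by
      rw [lengthGrading, lengthGrading, Submodule.span_mul_span, Submodule.span_le]
      rintro _ ⟨_, ⟨y', z, g, hg, rfl⟩, _, ⟨x, y, f, hf, rfl⟩, rfl⟩
      by_cases hy : y = y'
      · subst hy
        change basisVec k _ * basisVec k _ ∈ _
        rw [basisVec_mul_comp, add_comm]
        exact basisVec_mem_lengthGrading (hf.comp hg)
      · change basisVec k _ * basisVec k _ ∈ _
        rw [basisVec_mul_of_ne (by exact hy)]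
        exact Submodule.zero_mem _
    exact h (Submodule.mul_mem_mul ha hb)

open Classical in
/-- The length grading of the category algebra of a finite free EI category. -/
@[reducible] noncomputable def lengthGradedAlgebra (hE : IsFiniteFreeEI E) :
    GradedAlgebra (lengthGrading k E) :=
  let D : CatAlg k E →ₗ[k] DirectSum ℕ fun n => lengthGrading k E n := extend k fun m =>
    DirectSum.lof k ℕ (fun n => lengthGrading k E n) (hE.exists_hasLength m.hom).choose
      ⟨basisVec k m, basisVec_mem_lengthGrading (hE.exists_hasLength m.hom).choose_spec⟩
  { gradedMonoid_lengthGrading with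
    toDecomposition := DirectSum.Decomposition.ofLinearMap (lengthGrading k E) D
      (by
        refine linearMap_ext fun m => ?_
        rw [LinearMap.comp_apply, extend_basisVec, DirectSum.coeLinearMap_lof]
        rfl)
      (by
        refine DirectSum.linearMap_ext k fun n => LinearMap.ext fun ⟨a, ha⟩ => ?_
        simp only [LinearMap.comp_apply, DirectSum.coeLinearMap_lof, LinearMap.id_apply]
        induction ha using Submodule.span_induction with
        | zero => exact (map_zero D).trans (map_zero (DirectSum.lof k ℕ _ n)).symm
        | add u v hu hv hu' hv' =>
          rw [map_add, hu', hv', ← map_add]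
          rfl
        | smul c u hu hu' =>
          rw [map_smul, hu', ← map_smul]
          rfl
        | mem u hu =>
          obtain ⟨x, y, f, hf, rfl⟩ := hu
          obtain rfl := hE.hasLength_unique hf (hE.exists_hasLength f).choose_spec
          exact extend_basisVec k _ _) }

/-- Isomorphisms are homogeneous of degree 0 and the other morphisms of positive degree, so the
projection `π` fixes the former and kills the latter. -/
theorem mem_irrelevant_iff_mem_nonIsoSpan (hE : IsFiniteFreeEI E) (a : CatAlg k E) :
    letI := lengthGradedAlgebra (k := k) hE
    a ∈ ((HomogeneousIdeal.irrelevant (lengthGrading k E)).toIdeal) ↔ a ∈ nonIsoSpan k E := by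
  let := lengthGradedAlgebra (k := k) hE
  let π := GradedAlgebra.proj (lengthGrading k E) 0
  have h0 : ∀ m : Mor E, ¬ IsIso m.hom → π (basisVec k m) = 0 := fun ⟨x, y, f⟩ hf => by
    obtain ⟨n, hn⟩ := hE.exists_hasLength f
    have hn0 : n ≠ 0 := by
      rintro rfl
      rcases hn with hn | hn
      · exact hf hn.2
      · exact lt_irrefl _ hn.1
    exact DirectSum.decompose_of_mem_ne (lengthGrading k E) (basisVec_mem_lengthGrading hn) hn0
  have h1 : ∀ m : Mor E, IsIso m.hom → π (basisVec k m) = basisVec k m := fun ⟨x, y, f⟩ hf =>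
    DirectSum.decompose_of_mem_same (lengthGrading k E) (basisVec_mem_lengthGrading (Or.inl ⟨rfl, hf⟩))
  have h2 : (nonIsoSpan k E).mkQ ∘ₗ (LinearMap.id - π) = 0 := by
    refine linearMap_ext fun m => (Submodule.Quotient.mk_eq_zero _).2 ?_
    rw [LinearMap.sub_apply, LinearMap.id_apply]
    by_cases hm : IsIso m.hom
    · rw [h1 m hm, sub_self]
      exact Submodule.zero_mem _
    · rw [h0 m hm, sub_zero]
      exact Submodule.subset_span ⟨m, hm, rfl⟩
  have h3 : nonIsoSpan k E ≤ LinearMap.ker π :=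
    Submodule.span_le.2 fun _ ⟨m, hm, e⟩ => e ▸ h0 m hm
  change π a = 0 ↔ _
  refine ⟨fun h => ?_, fun h => h3 h⟩
  have := (Submodule.Quotient.mk_eq_zero _).1 congr($h2 a)
  rwa [LinearMap.sub_apply, h, sub_zero] at this

/-- The degree zero part of the category algebra satisfies Higman's criterion at all objects. -/
theorem hasUnitTrace_of_ker_eq (hE : IsFiniteFreeEI E) {M : Type*} [AddCommGroup M]
    [Module (CatAlg k E) M] (q : CatAlg k E →ₗ[CatAlg k E] M) (hq : Function.Surjective q)
    (hker : ∀ a, q a = 0 ↔ a ∈ nonIsoSpan k E) (x : E) [Fintype (Aut x)] :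
    HasUnitTrace (autHom k x) M := by
  classical
  -- Only the identity of `x` survives. For an automorphism `f` of `x`, the sum of the `g * θ (g⁻¹ *
  -- f)` has the single non-zero term `g = f`, equal to `f`; a non-isomorphism gives 0, which agrees
  -- with it modulo `nonIsoSpan`.
  let θ : CatAlg k E →ₗ[k] CatAlg k E := extend k fun m =>
    if m = ⟨x, x, 𝟙 x⟩ then basisVec k m else 0
  have hθ : ∀ m : Mor E, ¬ IsIso m.hom → θ (basisVec k m) = 0 := fun m hm => by
    rw [extend_basisVec, if_neg]
    rintro rfl
    exact hm inferInstance
  have hθ' : nonIsoSpan k E ≤ LinearMap.ker θ :=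
    Submodule.span_le.2 fun _ ⟨m, hm, e⟩ => e ▸ hθ m hm
  let θM : M →+ M := q.toAddMonoidHom.liftOfSurjective hq
    ⟨q.toAddMonoidHom.comp θ.toAddMonoidHom, fun a ha => by
      have : θ a = 0 := hθ' ((hker a).1 ha)
      change q (θ a) = 0
      rw [this, map_zero]⟩
  have hθM : ∀ a, θM (q a) = q (θ a) := fun a =>
    q.toAddMonoidHom.liftOfRightInverse_comp_apply _ (Function.rightInverse_surjInv hq) _ a
  refine ⟨θM, fun m => ?_⟩
  obtain ⟨a, rfl⟩ := hq m
  simp only [relTrace_apply, ← map_smul, hθM, ← map_sum]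
  rw [← sub_eq_zero, ← map_sub, hker]
  have key : (nonIsoSpan k E).mkQ ∘ₗ (∑ g : Aut x, LinearMap.mulLeft k (autHom k x g) ∘ₗ θ ∘ₗ
      LinearMap.mulLeft k (autHom k x g⁻¹) - LinearMap.mulLeft k (autHom k x 1)) = 0 := by
    refine linearMap_ext fun ⟨y, z, f⟩ => (Submodule.Quotient.mk_eq_zero _).2 ?_
    simp only [LinearMap.sub_apply, LinearMap.sum_apply, LinearMap.comp_apply,
      LinearMap.mulLeft_apply]
    by_cases hz : z = x
    · subst hz
      have h1 : autHom k z 1 * basisVec k ⟨y, z, f⟩ = basisVec k ⟨y, z, f⟩ := by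
        rw [autHom_mul]
        congr 2
        exact Category.comp_id f
      rw [h1]
      by_cases hf : IsIso f
      · obtain rfl : y = z := hE.skeletal ⟨asIso f⟩
        let t : Aut y := asIso f
        rw [Finset.sum_eq_single t]
        · have h2 : autHom k y t⁻¹ * basisVec k ⟨y, y, f⟩ = basisVec k ⟨y, y, 𝟙 y⟩ := by
            rw [autHom_mul]
            congr 2
            exact IsIso.hom_inv_id f
          rw [h2, extend_basisVec, if_pos rfl, autHom_mul, Category.id_comp]
          exact (sub_self (basisVec k (⟨y, y, f⟩ : Mor E))).symm ▸ Submodule.zero_mem _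
        · intro g _ hg
          rw [autHom_mul, extend_basisVec, if_neg, mul_zero]
          intro e
          simp only [Mor.mk.injEq, heq_eq_eq, true_and] at e
          exact hg (Iso.ext ((Iso.comp_inv_eq (show y ≅ y from g)).1 e |>.trans
            (Category.id_comp _)).symm)
        · simp
      · rw [Finset.sum_eq_zero, zero_sub]
        · exact Submodule.neg_mem _ (Submodule.subset_span ⟨_, hf, rfl⟩)
        · intro g _
          rw [autHom_mul, hθ _ fun h => hf (hE.ei.isIso_left _ _ h), mul_zero]
    · have h0 : ∀ g : Aut x, autHom k x g * basisVec k ⟨y, z, f⟩ = 0 := fun g =>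
        basisVec_mul_of_ne hz
      simp [h0]
  have := (Submodule.Quotient.mk_eq_zero _).1 congr($key a)
  simpa [LinearMap.sum_apply] using this

end CatAlg

/-! ### Vanishing of Ext in degrees at least two. -/

namespace CatAlg

section ExtVanishing

universe u v w

variable {k : Type u} {E : Type v} [Field k] [Category.{w} E] [Fintype E]

theorem exists_leftInverse {Y I : Type*} [AddCommGroup Y] [Module (CatAlg k E) Y]
    [AddCommGroup I] [Module (CatAlg k E) I] (j : Y →ₗ[CatAlg k E] I)
    (hj : Function.Injective j) : ∃ ρ : I →+ Y, ∀ y, ρ (j y) = y := by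
  let := Module.compHom I (algebraMap k (CatAlg k E))
  let := Module.compHom Y (algebraMap k (CatAlg k E))
  have : IsScalarTower k (CatAlg k E) I := IsScalarTower.of_algebraMap_smul fun _ _ => rfl
  have : IsScalarTower k (CatAlg k E) Y := IsScalarTower.of_algebraMap_smul fun _ _ => rfl
  obtain ⟨ρ, hρ⟩ := (j.restrictScalars k).exists_leftInverse_of_injective
    (LinearMap.ker_eq_bot.2 hj)
  exact ⟨ρ.toAddMonoidHom, fun y => congr($hρ y)⟩

variable [∀ x : E, Fintype (Aut x)]

variable (k E) in
/-- Higman's criterion for the automorphism groups of all right regular objects. -/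
def HasUnitTraces (M : Type*) [AddCommGroup M] [Module (CatAlg k E) M] : Prop :=
  ∀ x : E, RightRegular k x → HasUnitTrace (autHom k x) M

/-- The inductive step along cosyzygies: the criterion for `Y` yields equivariant sections of the
quotient map, and through them the cokernel inherits the criterion from the injective hull term
`S.X₂`. -/
theorem exists_injective_shortExact (Y : ModuleCat.{max u v w} (CatAlg k E))
    (hY : HasUnitTraces k E Y) :
    ∃ S : ShortComplex (ModuleCat.{max u v w} (CatAlg k E)), S.X₁ = Y ∧ Injective S.X₂ ∧
      S.ShortExact ∧ HasUnitTraces k E S.X₃ ∧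
      ∀ x : E, RightRegular k x → ∃ s : S.X₃ →+ S.X₂,
        (∀ g q, s (autHom k x g • q) = autHom k x g • s q) ∧
          ∀ q, S.g.hom (s q) = autHom k x 1 • q := by
  let S : ShortComplex (ModuleCat.{max u v w} (CatAlg k E)) :=
    ShortComplex.mk (Injective.ι Y) (Limits.cokernel.π _) (Limits.cokernel.condition _)
  have hI : Injective S.X₂ := inferInstanceAs (Injective (Injective.under Y))
  have hS : S.ShortExact :=
    { exact := ShortComplex.exact_cokernel _
      mono_f := inferInstanceAs (Mono (Injective.ι Y))
      epi_g := inferInstanceAs (Epi (Limits.cokernel.π (Injective.ι Y))) }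
  have hIM : Module.Injective (CatAlg k E) S.X₂ :=
    Module.injective_module_of_injective_object (inj := hI)
  have hsec : ∀ x : E, RightRegular k x → ∃ s : S.X₃ →+ S.X₂,
      (∀ g q, s (autHom k x g • q) = autHom k x g • s q) ∧
        ∀ q, S.g.hom (s q) = autHom k x 1 • q := fun x hx => by
    obtain ⟨ρ, hρ⟩ := exists_leftInverse S.f.hom hS.moduleCat_injective_f
    exact (hY x hx).exists_section S.f.hom S.g.hom
      ((ShortComplex.ShortExact.moduleCat_exact_iff_function_exact S).1 hS.exact)
      hS.moduleCat_surjective_g ρ hρ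
  refine ⟨S, rfl, hI, hS, fun x hx => ?_, hsec⟩
  obtain ⟨τ, hτ⟩ := exists_trace_of_rightRegular hx
  have hI' : HasUnitTrace (autHom k x) S.X₂ :=
    HasUnitTrace.of_injective (fun r hr => hIM.out r hr LinearMap.id) τ hτ
  obtain ⟨s, hs1, hs2⟩ := hsec x hx
  exact hI'.of_section S.g.hom s hs1 hs2

/-- A class in `Ext¹` is the connecting image of a map from `J` to the cokernel; that map lifts to
the injective module, so the class is zero. Higher degrees shift down to the cokernel, which is why
`Y` varies in the induction. -/
theorem ext_nonIso_eq_zero (hE : IsFiniteFreeEI E)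
    (hreg : ∀ x : E, LeftRegular k x ∨ RightRegular k x)
    (J : Submodule (CatAlg k E) (CatAlg k E)) (hJ : ∀ a, a ∈ J ↔ a ∈ nonIsoSpan k E) (n : ℕ) :
    ∀ (Y : ModuleCat.{max u v w} (CatAlg k E)), HasUnitTraces k E Y →
      ∀ e : Abelian.Ext (ModuleCat.of (CatAlg k E) J) Y (n + 1), e = 0 := by
  induction n with
  | zero =>
    intro Y hY e
    obtain ⟨S, rfl, hI, hS, -, hs⟩ := exists_injective_shortExact Y hY
    obtain ⟨f, rfl⟩ := Abelian.Ext.covariant_sequence_exact₁ _ hS e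
      (Abelian.Ext.eq_zero_of_injective _) rfl
    obtain ⟨f, rfl⟩ := (Abelian.Ext.mk₀_bijective _ _).2 f
    obtain ⟨F, hF⟩ := exists_lift_nonIso hE hreg J hJ S.g.hom hS.moduleCat_surjective_g hs f.hom
    obtain rfl : ModuleCat.ofHom F ≫ S.g = f := ModuleCat.hom_ext (LinearMap.ext hF)
    rw [← Abelian.Ext.mk₀_comp_mk₀, Abelian.Ext.comp_assoc_of_second_deg_zero, hS.comp_extClass,
      Abelian.Ext.comp_zero]
  | succ n ih =>
    intro Y hY e
    obtain ⟨S, rfl, hI, hS, hQ, -⟩ := exists_injective_shortExact Y hY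
    obtain ⟨f, rfl⟩ := Abelian.Ext.covariant_sequence_exact₁ _ hS e
      (Abelian.Ext.eq_zero_of_injective _) rfl
    rw [ih S.X₃ hQ f, Abelian.Ext.zero_comp]

theorem ext_quotient_eq_zero (hE : IsFiniteFreeEI E)
    (hreg : ∀ x : E, LeftRegular k x ∨ RightRegular k x)
    (J : Submodule (CatAlg k E) (CatAlg k E)) (hJ : ∀ a, a ∈ J ↔ a ∈ nonIsoSpan k E) (n : ℕ)
    (e : Abelian.Ext (ModuleCat.of (CatAlg k E) (CatAlg k E ⧸ J))
      (ModuleCat.of (CatAlg k E) (CatAlg k E ⧸ J)) (n + 2)) : e = 0 := by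
  have hS := J.mkQ.shortExact_shortComplexKer J.mkQ_surjective
  have hker : ∀ a, J.mkQ a = 0 ↔ a ∈ nonIsoSpan k E := fun a =>
    (Submodule.Quotient.mk_eq_zero J).trans (hJ a)
  have hP : Projective (ModuleCat.of (CatAlg k E) (CatAlg k E)) := inferInstance
  obtain ⟨f, rfl⟩ := Abelian.Ext.contravariant_sequence_exact₃ hS _ e
    (Abelian.Ext.eq_zero_of_projective (P := ModuleCat.of (CatAlg k E) (CatAlg k E)) _)
    (n₀ := n + 1) (add_comm _ _)
  have hY : HasUnitTraces k E (ModuleCat.of (CatAlg k E) (CatAlg k E ⧸ J)) := fun x _ =>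
    hasUnitTrace_of_ker_eq hE J.mkQ J.mkQ_surjective hker x
  rw [show f = 0 from ext_nonIso_eq_zero hE hreg _ hker n _ hY f, Abelian.Ext.comp_zero]

end ExtVanishing

end CatAlg

theorem theorem6p16 {k : Type*} [Field k] {E : Type*} [Category E] [Fintype E]
    (hE : IsFiniteFreeEI E)
    (hreg : ∀ x : E, LeftRegular k x ∨ RightRegular k x) :
    ∃ _ : GradedAlgebra (lengthGrading k E), IsQuasiKoszulAlgebra (lengthGrading k E) := by
  have : ∀ x : E, Fintype (Aut x) := fun x => by
    have := hE.finite_hom x x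
    have : Finite (Aut x) := Finite.of_injective (fun g : Aut x => g.hom) fun g h e => Iso.ext e
    exact Fintype.ofFinite _
  let := CatAlg.lengthGradedAlgebra (k := k) hE
  refine ⟨this, fun i => ?_⟩
  rw [eq_top_iff]
  intro z _
  cases i with
  | zero =>
    -- For `i = 0`, every class is its own product with the identity in `Ext⁰`.
    exact AddSubgroup.subset_closure
      ⟨Abelian.Ext.mk₀ (𝟙 _), z, (Abelian.Ext.mk₀_id_comp z).symm⟩
  | succ n =>
    rw [show z = 0 from CatAlg.ext_quotient_eq_zero hE hreg _
      (CatAlg.mem_irrelevant_iff_mem_nonIsoSpan hE) n z]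
    exact AddSubgroup.zero_mem _
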